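/- Let $\mathcal D=(V,E)$ be a finite directed acyclic graph, and let $\boldsymbol X=(X_i)_{i\in V}$ satisfy the linear structural equations $$X_i=\sum_{j\in \mathrm{pa}(i)}c_{ij}X_j+s_{ii}Z_i,\qquad i\in V,$$ with $c_{ij}>0$ for every edge $j\to i$ and $s_{ii}>0$ for every $i$, where the innovations $Z_i\ge 0$ are independent and $n\,\mathbb P(n^{-1/2}Z_i>z)\to z^{-2}$ as $n\to\infty$ for all $z>0$ and $i\in V$. Let $\boldsymbol X$ be multivariate regularly varying with index $2$ with respect to the Euclidean norm and the normalising sequence $b_n=n^{1/2}$, with angular measure $H_{\boldsymbol X}$. That is, $H_{\boldsymbol X}$ is a finite measure on $\Theta_+=\{\boldsymbol\omega\in\mathbb R_+^V:\|\boldsymbol\omega\|=1\}$ such that, with $R=\|\boldsymbol X\|$, the measures $n\,\mathbb P((R/n^{1/2},\boldsymbol X/R)\in\cdot)$ converge vaguely on $(0,\infty]\times\Theta_+$ to $2x^{-3}\,dx\times H_{\boldsymbol X}$. For $b_k\ge 0$ and non-empty $S\subset V$, the squared scaling of $M=\max_{k\in S}b_kX_k$ is $$\sigma_M^2=\int_{\Theta_+}\max_{k\in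 S}(b_k\omega_k)^2\,dH_{\boldsymbol X}(\boldsymbol\omega),$$ and the components of $\boldsymbol X$ are assumed to be standardised, i.e. $\sigma_{X_i}^2=1$ for all $i\in V$. Write $\mathrm{an}(i)$ for the set of ancestors of $i$ in $\mathcal D$. Let $I\subset V$ satisfy $\mathrm{an}(i)\subset I$ for all $i\in I$, let $I^c=V\setminus I$ and let $j\in I^c$. For $a>1$ and $i\notin I\cup\{j\}$ put $M_{i,aj,aI}=\max(X_i,\,aX_j,\,a\max_{k\in I}X_k)$, $M_{i,j,I}=\max(X_i,X_j,\max_{k\in I}X_k)$ and $M_{j,I}=\max(X_j,\max_{k\in I}X_k)$, where the maxima over $I$ are omitted if $I=\emptyset$. Then $\mathrm{an}(j)\subset I$ if and only if there exists a scalar $a>1$ such that $$\sigma^2_{M_{i,aj,aI}}-\sigma^2_{M_{i,j,I}}=(a^2-1)\,\sigma^2_{M_{j,I}}\qquad\text{for all } i\notin I\cup\{j\}.$$ Otherwise, i.e. if $j$ has an ancestor outside $I$, then for every $a>1$ and every $i\notin I\cup\{j\}$ $$\sigma^2_{M_{i,aj,aI}}-\sigma^2_{M_{i,j,I}}\le(a^2-1)\,\sigma^2_{M_{j,I}},$$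 with strict inequality whenever $i\in I^c\cap\mathrm{an}(j)$. -/

import Mathlib

open MeasureTheory ProbabilityTheory Filter Topology Set
open scoped ENNReal

namespace ExtremalLSEM

/-! ### Directed graphs -/

section Graph

variable {V : Type*}

/-- The ancestors `an(i)` of a node `i`: the nodes `j` with a directed path of length at least one
from `j` to `i`. -/
def ancestors (D : Digraph V) (i : V) : Set V :=
  {j | Relation.TransGen D.Adj j i}

/-- A directed graph is acyclic if no node is its own ancestor. -/
def IsAcyclic (D : Digraph V) : Prop :=
  ∀ i, i ∉ ancestors D i

open Classical in
/-- The parents `pa(i)` of a node `i`: the nodes `j` with an edge `j → i`. -/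
noncomputable def parents [Fintype V] (D : Digraph V) (i : V) : Finset V :=
  Finset.univ.filter fun j => D.Adj j i

end Graph

/-! ### Multivariate regular variation with index two and Euclidean norm -/

section RegularVariation

/-- Vague convergence of measures on `E`: convergence of the integrals of all continuous functions
with compact support. -/
def VagueTendsto {E : Type*} [TopologicalSpace E] [MeasurableSpace E]
    (μ : ℕ → Measure E) (μ' : Measure E) : Prop :=
  ∀ f : E → ℝ, Continuous f → HasCompactSupport f →
    Tendsto (fun n => ∫ x, f x ∂(μ n)) atTop (𝓝 (∫ x, f x ∂μ'))

/-- The half-line `(0, ∞]`, in which the sets `[ε, ∞]` with `ε > 0` are compact. -/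
abbrev Radii : Type := Set.Ioi (0 : ℝ≥0∞)

/-- The positive part `{ω ≥ 0 : ‖ω‖ = 1}` of the Euclidean unit sphere of `ℝ^V`. -/
abbrev PosSphere (V : Type*) [Fintype V] : Type _ :=
  {θ : EuclideanSpace ℝ V // (∀ i, 0 ≤ θ i) ∧ ‖θ‖ = 1}

/-- The measure `2 x⁻³ dx` on `(0, ∞]`, which has no mass at `∞`. -/
noncomputable def radialMeasure : Measure Radii :=
  Measure.comap Subtype.val
    (Measure.map ENNReal.ofReal
      ((volume.restrict (Set.Ioi (0 : ℝ))).withDensity fun x => ENNReal.ofReal (2 / x ^ 3)))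

variable {V : Type*} [Fintype V] {Ω : Type*} [MeasurableSpace Ω]

/-- The measure `P((R / b, X / R) ∈ ·)` on `(0, ∞] × Θ₊`, where `R = ‖X‖`. (Outcomes with `R = 0`
have `R / b = 0 ∉ (0, ∞]` and do not contribute.) -/
noncomputable def polarLaw (P : Measure Ω) (X : Ω → EuclideanSpace ℝ V) (b : ℝ) :
    Measure (Radii × PosSphere V) :=
  Measure.comap (fun p : Radii × PosSphere V => ((p.1 : ℝ≥0∞), (p.2 : EuclideanSpace ℝ V)))
    (Measure.map (fun ω => (ENNReal.ofReal (‖X ω‖ / b), ‖X ω‖⁻¹ • X ω)) P)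

/-- `X` is multivariate regularly varying with index `2` and angular measure `H`, with the
standard normalising sequence `b_n = n^{1/2}`: the measure `H` on `Θ₊` is finite and
`n P((R / b_n, X / R) ∈ ·)` converges vaguely to `2 x⁻³ dx × H` on `(0, ∞] × Θ₊`. -/
structure IsAngularMeasure (P : Measure Ω) (X : Ω → EuclideanSpace ℝ V)
    (H : Measure (PosSphere V)) : Prop where
  finite : IsFiniteMeasure H
  tendsto : VagueTendsto (fun n : ℕ => (n : ℝ≥0∞) • polarLaw P X (√(n : ℝ)))
    (radialMeasure.prod H)

/-- The squared scaling `∫ max_{k ∈ S} (b_k ω_k)² dH(ω)` of the rescaled maximum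
`max_{k ∈ S} b_k X_k` of a vector `X` with angular measure `H`. -/
noncomputable def sqScaling (H : Measure (PosSphere V)) (S : Finset V) (hS : S.Nonempty)
    (b : V → ℝ) : ℝ :=
  ∫ θ : PosSphere V, S.sup' hS (fun k => (b k * (θ : EuclideanSpace ℝ V) k) ^ 2) ∂H

end RegularVariation

/-! ### Linear structural equation models with positive weights -/

section Model

variable {V : Type*} [Fintype V] {Ω : Type*} [MeasurableSpace Ω]

/-- The innovations `Z` are nonnegative, independent and standardised, that is, for every node `i`
and `z > 0`, `n P(n^{-1/2} Z_i > z) → z⁻²`. -/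
structure IsInnovation (P : Measure Ω) (Z : V → Ω → ℝ) : Prop where
  measurable : ∀ i, Measurable (Z i)
  nonneg : ∀ i, ∀ᵐ ω ∂P, 0 ≤ Z i ω
  indep : iIndepFun Z P
  standardised : ∀ i, ∀ z : ℝ, 0 < z →
    Tendsto (fun n : ℕ => (n : ℝ) * P.real {ω | z < Z i ω / √(n : ℝ)}) atTop (𝓝 ((z ^ 2)⁻¹))

/-- `X` follows the linear structural equation model `X_i = ∑_{j ∈ pa(i)} c_{ij} X_j + s_i Z_i` on
the directed acyclic graph `D`, where the weight of every edge and every innovation weight is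
positive. -/
structure IsLSEMPlus (P : Measure Ω) (D : Digraph V) (c : V → V → ℝ) (s : V → ℝ)
    (Z : V → Ω → ℝ) (X : Ω → EuclideanSpace ℝ V) : Prop where
  acyclic : IsAcyclic D
  edge_pos : ∀ i, ∀ j ∈ parents D i, 0 < c i j
  innov_pos : ∀ i, 0 < s i
  measurable : Measurable X
  equation : ∀ᵐ ω ∂P, ∀ i, X ω i = ∑ j ∈ parents D i, c i j * X ω j + s i * Z i ω

end Model

section Maxima

variable {V : Type*} [Fintype V] [DecidableEq V]

/-- The squared scaling of `X_i`. -/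
noncomputable def sqScalingNode (H : Measure (PosSphere V)) (i : V) : ℝ :=
  sqScaling H {i} (Finset.singleton_nonempty i) (fun _ => 1)

/-- The squared scaling of `M_{j,I} = max(X_j, X_I)`. -/
noncomputable def sqScalingMax (H : Measure (PosSphere V)) (j : V) (I : Finset V) : ℝ :=
  sqScaling H (insert j I) (Finset.insert_nonempty j I) (fun _ => 1)

/-- The squared scaling of `M_{i,aj,aI} = max(X_i, a X_j, a X_I)`, for `i ∉ I ∪ {j}`. -/
noncomputable def sqScalingMaxRescaled (H : Measure (PosSphere V)) (a : ℝ) (i j : V)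
    (I : Finset V) : ℝ :=
  sqScaling H (insert i (insert j I)) (Finset.insert_nonempty i (insert j I))
    (fun k => if k = i then 1 else a)

end Maxima

end ExtremalLSEM

open ExtremalLSEM

/-!
The vector `X` solves its structural equations as `X = ∑ l, Z l • a l`, where the coefficient
`a l k = T k l * s l` sums the weights of all directed paths from `l` to `k`
(`IsPathWeight.solve`). Since the independent innovations have tails of order `z⁻²`, only one of
them is large when `‖X‖` is large, so that the angular measure is discrete, with mass `‖a l‖ ^ 2`
at `a l / ‖a l‖` (`integral_angularMeasure`). Consequently the squared scaling of
`max_{k ∈ S} b k * X k` is `∑ l, max_{k ∈ S} (b k * a l k) ^ 2` (`sqScaling_eq_sum`).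

The angular measure is identified by testing the vague convergence against products
`ramp r * f θ`. For the left-hand side, `abs_polarTest_sum_sub_le` replaces the test function of a
sum by the sum of the test functions of its terms, up to events in which two innovations are large
(`IsInnovation.tendsto_sub`), and the limit for one innovation is found from its tail by the
layer-cake formula (`tendsto_integral_ramp`).

With `m l = max_{k ∈ I ∪ {j}} (a l k) ^ 2`, both sides of the claimed relation are then sums over
`l`, and each term obeys `max x (a² m) - max x m ≤ (a² - 1) m` for `x = (a l i) ^ 2`. There is
equality if `x ≤ m` or `m = 0`, and strict inequality if `0 < m < x`. Standardisation says that all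
rows of the coefficient matrix have norm one. As the row of `i` dominates `T i k` times the row of
`k`, this gives `T i k < 1` for `i ≠ k`, that is, `a k i < a k k` (`IsPathWeight.lt_one`).

* If `an(j) ⊆ I`, then `I ∪ {j}` is closed under ancestors. Hence `m l = 0` for `l ∉ I ∪ {j}`, and
  `x ≤ (a l l) ^ 2 ≤ m l` for `l ∈ I ∪ {j}`, so there is equality for every `a > 1`.
* If `i ∈ an(j)` lies outside `I`, then the term of `l = i` is strict: `m i` is positive because
  `a i j > 0`, and it is less than `(a i i) ^ 2`.
-/

namespace ExtremalLSEM

/-! ### Path weights of an acyclic graph -/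

section PathWeights

variable {V : Type*} [Fintype V]

lemma mem_parents {D : Digraph V} {i j : V} : j ∈ parents D i ↔ D.Adj j i := by
  simp [parents]

lemma IsAcyclic.wellFounded {D : Digraph V} (hD : IsAcyclic D) : WellFounded D.Adj := by
  have : Std.Irrefl (Relation.TransGen D.Adj) := ⟨fun i h => hD i h⟩
  exact Subrelation.wf Relation.TransGen.single
    (Finite.wellFounded_of_trans_of_irrefl (Relation.TransGen D.Adj))

/-- `T i k` is the sum, over all directed paths from `k` to `i`, of the products of the weights
`c` along the path, the empty path having weight one. This is encoded by splitting off the last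
edge of a path, so that `T = (1 - C)⁻¹` for the matrix `C` of edge weights. -/
def IsPathWeight [DecidableEq V] (D : Digraph V) (c T : V → V → ℝ) : Prop :=
  ∀ i k, T i k = (if i = k then 1 else 0) + ∑ j ∈ parents D i, c i j * T j k

variable [DecidableEq V] {D : Digraph V} {c T : V → V → ℝ}

lemma exists_isPathWeight (hD : IsAcyclic D) (c : V → V → ℝ) :
    ∃ T : V → V → ℝ, IsPathWeight D c T := by
  let F : ∀ i, (∀ j, D.Adj j i → V → ℝ) → V → ℝ := fun i rec k => (if i = k then 1 else 0) +
    ∑ j ∈ (parents D i).attach, c i j * rec j (mem_parents.1 j.2) k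
  refine ⟨hD.wellFounded.fix F, fun i k => ?_⟩
  rw [WellFounded.fix_eq]
  exact congrArg _ (Finset.sum_attach (parents D i) fun j => c i j * hD.wellFounded.fix F j k)

namespace IsPathWeight

lemma nonneg (hT : IsPathWeight D c T) (hD : IsAcyclic D)
    (hc : ∀ i, ∀ j ∈ parents D i, 0 < c i j) (i k : V) : 0 ≤ T i k := by
  induction i using hD.wellFounded.induction with
  | _ i ih =>
    rw [hT i k]
    refine add_nonneg (by split_ifs <;> norm_num) (Finset.sum_nonneg fun j hj => ?_)
    exact mul_nonneg (hc i j hj).le (ih j (mem_parents.1 hj))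

lemma eq_zero (hT : IsPathWeight D c T) (hD : IsAcyclic D) {i k : V} (hik : i ≠ k)
    (hk : k ∉ ancestors D i) : T i k = 0 := by
  induction i using hD.wellFounded.induction with
  | _ i ih =>
    rw [hT i k, if_neg hik, zero_add]
    refine Finset.sum_eq_zero fun j hj => ?_
    have hji : D.Adj j i := mem_parents.1 hj
    rw [ih j hji ?_ fun h => hk (Relation.TransGen.tail h hji), mul_zero]
    rintro rfl
    exact hk (Relation.TransGen.single hji)

lemma self (hT : IsPathWeight D c T) (hD : IsAcyclic D) (i : V) : T i i = 1 := by
  rw [hT i i, if_pos rfl, Finset.sum_eq_zero, add_zero]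
  intro j hj
  have hji : D.Adj j i := mem_parents.1 hj
  rw [hT.eq_zero hD, mul_zero]
  · rintro rfl
    exact hD j (Relation.TransGen.single hji)
  · exact fun h => hD i (Relation.TransGen.tail h hji)

/-- The paths from `k` to `i` with last edge `j → i` contribute `c i j * T j k` to `T i k`. -/
lemma edge_le (hT : IsPathWeight D c T) (hD : IsAcyclic D)
    (hc : ∀ i, ∀ j ∈ parents D i, 0 < c i j) {i j : V} (hji : D.Adj j i) (k : V) :
    c i j * T j k ≤ T i k := by
  rw [hT i k]
  have h := Finset.single_le_sum (f := fun j => c i j * T j k)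
    (fun l hl => mul_nonneg (hc i l hl).le (hT.nonneg hD hc l k)) (mem_parents.2 hji)
  have h0 : (0 : ℝ) ≤ if i = k then 1 else 0 := by split_ifs <;> norm_num
  exact h.trans (le_add_of_nonneg_left h0)

lemma pos (hT : IsPathWeight D c T) (hD : IsAcyclic D)
    (hc : ∀ i, ∀ j ∈ parents D i, 0 < c i j) {i k : V} (hk : k ∈ ancestors D i) :
    0 < T i k := by
  have hk' : Relation.TransGen D.Adj k i := hk
  induction hk' with
  | single h =>
    refine lt_of_lt_of_le ?_ (hT.edge_le hD hc h k)
    rw [hT.self hD, mul_one]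
    exact hc _ _ (mem_parents.2 h)
  | tail h h' ih =>
    exact (mul_pos (hc _ _ (mem_parents.2 h')) (ih h)).trans_le (hT.edge_le hD hc h' k)

/-- The paths from `l` to `i` through `k` contribute `T i k * T k l` to `T i l`. -/
lemma mul_le (hT : IsPathWeight D c T) (hD : IsAcyclic D)
    (hc : ∀ i, ∀ j ∈ parents D i, 0 < c i j) (i k l : V) : T i k * T k l ≤ T i l := by
  induction i using hD.wellFounded.induction with
  | _ i ih =>
    rcases eq_or_ne i k with rfl | hik
    · rw [hT.self hD, one_mul]
    rw [hT i k, if_neg hik, zero_add, Finset.sum_mul, hT i l]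
    have h0 : (0 : ℝ) ≤ if i = l then 1 else 0 := by split_ifs <;> norm_num
    refine (Finset.sum_le_sum fun j hj => ?_).trans (le_add_of_nonneg_left h0)
    rw [mul_assoc]
    exact mul_le_mul_of_nonneg_left (ih j (mem_parents.1 hj)) (hc i j hj).le

/-- The structural equations are solved by expanding every variable in the innovations. -/
lemma solve (hT : IsPathWeight D c T) (hD : IsAcyclic D) {x y : V → ℝ}
    (h : ∀ i, x i = ∑ j ∈ parents D i, c i j * x j + y i) (i : V) :
    x i = ∑ k, T i k * y k := by
  induction i using hD.wellFounded.induction with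
  | _ i ih =>
    rw [h i, Finset.sum_congr rfl fun j hj => by rw [ih j (mem_parents.1 hj), Finset.mul_sum],
      Finset.sum_comm]
    simp_rw [hT i, add_mul, Finset.sum_add_distrib, Finset.sum_mul, ite_mul, one_mul, zero_mul,
      Finset.sum_ite_eq, Finset.mem_univ, if_true, mul_assoc]
    ring

/-- If the rows of `(T i k * s k)` have Euclidean norm one, then `T i k < 1` for `i ≠ k`: the row
of `i` dominates `T i k` times the row of `k` and has the additional entry `s i`. -/
lemma lt_one (hT : IsPathWeight D c T) (hD : IsAcyclic D)
    (hc : ∀ i, ∀ j ∈ parents D i, 0 < c i j) {s : V → ℝ} (hs : ∀ i, 0 < s i)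
    (hstd : ∀ i, ∑ k, (T i k * s k) ^ 2 = 1) {i k : V} (hik : i ≠ k) : T i k < 1 := by
  by_cases hk : k ∈ ancestors D i
  swap
  · rw [hT.eq_zero hD hik hk]
    exact one_pos
  have hki : T k i = 0 := hT.eq_zero hD hik.symm fun h => hD k (Relation.TransGen.trans hk h)
  have hT0 := hT.nonneg hD hc
  have h1 : ∑ l, (T i k * (T k l * s l)) ^ 2 < ∑ l, (T i l * s l) ^ 2 := by
    refine Finset.sum_lt_sum (fun l _ => ?_) ⟨i, Finset.mem_univ i, ?_⟩
    · rw [← mul_assoc]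
      exact pow_le_pow_left₀ (mul_nonneg (mul_nonneg (hT0 _ _) (hT0 _ _)) (hs l).le)
        (mul_le_mul_of_nonneg_right (hT.mul_le hD hc i k l) (hs l).le) 2
    · rw [hki, hT.self hD]
      have := hs i
      simpa using pow_pos this 2
  simp_rw [mul_pow (T i k)] at h1
  rw [← Finset.mul_sum, hstd, hstd, mul_one] at h1
  exact (sq_lt_one_iff₀ (hT0 i k)).1 h1

end IsPathWeight

end PathWeights

/-! ### Maxima with a rescaled argument -/

section Algebra

/-- The inequality behind the comparison of squared scalings, to be applied with `b = a ^ 2` to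
each atom of the angular measure. -/
lemma max_mul_sub_max_le {x y b : ℝ} (hy : 0 ≤ y) (hb : 1 < b) :
    max x (b * y) - max x y ≤ (b - 1) * y := by
  have : y ≤ b * y := le_mul_of_one_le_left hy hb.le
  rcases le_total x y with h | h <;> rcases le_total x (b * y) with h' | h' <;>
    simp only [max_eq_left, max_eq_right, h, h'] <;> nlinarith

lemma max_mul_sub_max_eq {x y b : ℝ} (hy : 0 ≤ y) (hb : 1 < b) (hxy : x ≤ y) :
    max x (b * y) - max x y = (b - 1) * y := by
  have : y ≤ b * y := le_mul_of_one_le_left hy hb.le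
  rw [max_eq_right hxy, max_eq_right (hxy.trans this)]
  ring

lemma max_mul_sub_max_lt {x y b : ℝ} (hy : 0 < y) (hb : 1 < b) (hxy : y < x) :
    max x (b * y) - max x y < (b - 1) * y := by
  rw [max_eq_left hxy.le]
  rcases le_total x (b * y) with h | h <;> simp only [max_eq_left, max_eq_right, h] <;> nlinarith

variable {V : Type*} [DecidableEq V]

/-- The integrand of the squared scaling of the rescaled maximum: the factor `a` of the nodes in
`S` comes out of the maximum over `S`. -/
lemma sup'_insert_rescale (g : V → ℝ) {i : V} {S : Finset V} (hS : S.Nonempty) (hi : i ∉ S)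
    (a : ℝ) :
    (insert i S).sup' (Finset.insert_nonempty i S) (fun k => ((if k = i then 1 else a) * g k) ^ 2)
      = max (g i ^ 2) (a ^ 2 * S.sup' hS fun k => g k ^ 2) := by
  rw [Finset.sup'_insert hS]
  simp only [if_true, one_mul]
  congr 1
  rw [Finset.sup'_congr hS rfl (g := fun k => a ^ 2 * g k ^ 2)]
  · exact (Finset.apply_sup'_eq_sup'_comp hS (fun x => a ^ 2 * x)
      fun x y => mul_max_of_nonneg x y (sq_nonneg a)).symm
  · intro k hk
    rw [if_neg (by rintro rfl; exact hi hk), mul_pow]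

end Algebra

/-! ### A radial test function -/

section Ramp

/-- The continuous function that is `0` up to `1`, is `1` from `2` on, and is linear between. -/
noncomputable def ramp (x : ℝ) : ℝ := min (max (x - 1) 0) 1

lemma ramp_nonneg (x : ℝ) : 0 ≤ ramp x := le_min (le_max_right _ _) zero_le_one

lemma ramp_le_one (x : ℝ) : ramp x ≤ 1 := min_le_right _ _

lemma ramp_eq_zero {x : ℝ} (hx : x ≤ 1) : ramp x = 0 := by
  rw [ramp, max_eq_right (by linarith), min_eq_left zero_le_one]

lemma continuous_ramp : Continuous ramp := by unfold ramp; fun_prop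

lemma abs_ramp_sub_ramp_le (x y : ℝ) : |ramp x - ramp y| ≤ |x - y| := by
  refine (abs_min_sub_min_le_max _ _ _ _).trans (max_le ?_ (by simp))
  refine (abs_max_sub_max_le_max _ _ _ _).trans (max_le ?_ (by simp))
  rw [sub_sub_sub_cancel_right]

lemma lt_ramp_iff {t x : ℝ} (ht : 0 ≤ t) : t < ramp x ↔ t < 1 ∧ 1 + t < x := by
  rw [ramp, lt_min_iff, lt_max_iff, and_comm, lt_sub_iff_add_lt', or_iff_left ht.not_gt]

/-- The extension of `ramp` to `[0, ∞]`, with the value `1` at `∞`. -/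
noncomputable def rampENN (r : ℝ≥0∞) : ℝ := (min (r - 1) 1).toReal

lemma rampENN_ofReal (x : ℝ) : rampENN (ENNReal.ofReal x) = ramp x := by
  rw [rampENN, ← ENNReal.ofReal_one, ← ENNReal.ofReal_sub _ zero_le_one,
    ENNReal.toReal_min ENNReal.ofReal_ne_top ENNReal.ofReal_ne_top, ENNReal.toReal_ofReal',
    ENNReal.toReal_ofReal zero_le_one, ramp]

lemma rampENN_eq_zero {r : ℝ≥0∞} (hr : r ≤ 1) : rampENN r = 0 := by
  rw [rampENN, tsub_eq_zero_of_le hr, min_eq_left zero_le_one, ENNReal.toReal_zero]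

lemma continuous_rampENN : Continuous rampENN := by
  refine ENNReal.continuousOn_toReal.comp_continuous
    ((ENNReal.continuous_sub_right 1).min continuous_const) fun r => ?_
  exact ne_top_of_le_ne_top ENNReal.one_ne_top (min_le_right _ _)

/-- The layer-cake formula: integrals of `ramp` depend on the tails at the levels `1 + t`,
`0 < t < 1`, only. -/
lemma integral_ramp {Ω : Type*} [MeasurableSpace Ω] {μ : Measure Ω} {Y : Ω → ℝ}
    (hY : Integrable (fun ω => ramp (Y ω)) μ) :
    ∫ ω, ramp (Y ω) ∂μ =
      ∫ t in Ioi (0 : ℝ), (Iio 1).indicator (fun t => μ.real {ω | 1 + t < Y ω}) t := by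
  rw [hY.integral_eq_integral_meas_lt (ae_of_all _ fun ω => ramp_nonneg _)]
  refine setIntegral_congr_fun measurableSet_Ioi fun t ht => ?_
  simp only [lt_ramp_iff (le_of_lt (mem_Ioi.1 ht))]
  by_cases h : t < 1 <;> simp [h]

/-- The integral of `ramp` with respect to `2 x⁻³ dx`, in layer-cake form. -/
noncomputable def rampMass : ℝ :=
  ∫ t in Ioi (0 : ℝ), (Iio 1).indicator (fun t => ((1 + t) ^ 2)⁻¹) t

lemma integrable_indicator_Iio_const (B : ℝ) :
    Integrable ((Iio (1 : ℝ)).indicator fun _ => B) (volume.restrict (Ioi (0 : ℝ))) := by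
  rw [integrable_indicator_iff measurableSet_Iio]
  refine integrableOn_const ?_
  rw [Measure.restrict_apply measurableSet_Iio, inter_comm, Ioi_inter_Iio]
  exact measure_Ioo_lt_top.ne

lemma rampMass_pos : 0 < rampMass := by
  have hint : Integrable ((Iio (1 : ℝ)).indicator fun t => ((1 + t) ^ 2)⁻¹)
      (volume.restrict (Ioi (0 : ℝ))) := by
    refine (integrable_indicator_Iio_const 1).mono' ?_ ?_
    · exact (Measurable.indicator (by fun_prop) measurableSet_Iio).aestronglyMeasurable
    · refine (ae_restrict_iff' measurableSet_Ioi).2 (ae_of_all _ fun t ht => ?_)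
      have ht : 0 < t := ht
      rw [norm_indicator_eq_indicator_norm]
      refine indicator_le_indicator ?_
      rw [norm_inv, norm_pow, Real.norm_of_nonneg (by linarith)]
      exact inv_le_one_of_one_le₀ (one_le_pow₀ (by linarith))
  rw [rampMass, integral_pos_iff_support_of_nonneg_ae ?_ hint]
  · refine lt_of_lt_of_le ?_ (measure_mono (s := Ioo (0 : ℝ) 1) fun t ht => ?_)
    · rw [Measure.restrict_apply measurableSet_Ioo, inter_eq_left.2 Ioo_subset_Ioi_self]
      simp
    · have : 1 + t ≠ 0 := by linarith [ht.1]
      simp [ht.2, this]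
  · exact ae_of_all _ fun t => indicator_nonneg (fun t _ => by positivity) t

end Ramp

/-! ### The radial measure -/

section Radial

/-- The measure `2 x⁻³ dx` on the positive reals. -/
noncomputable def paretoMeasure : Measure ℝ :=
  (volume.restrict (Ioi (0 : ℝ))).withDensity fun x => ENNReal.ofReal (2 / x ^ 3)

lemma paretoMeasure_Ioi {u : ℝ} (hu : 0 < u) :
    paretoMeasure (Ioi u) = ENNReal.ofReal (u ^ 2)⁻¹ := by
  have hpow : ∀ x ∈ Ioi u, 2 / x ^ 3 = 2 * x ^ (-3 : ℝ) := fun x hx => by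
    have hx : 0 < x := hu.trans hx
    rw [Real.rpow_neg hx.le, div_eq_mul_inv]
    norm_cast
  have hint : IntegrableOn (fun x : ℝ => 2 / x ^ 3) (Ioi u) :=
    IntegrableOn.congr_fun
      ((integrableOn_Ioi_rpow_of_lt (a := -3) (by norm_num) hu).const_mul 2 :)
      (fun x hx => (hpow x hx).symm) measurableSet_Ioi
  rw [paretoMeasure, withDensity_apply _ measurableSet_Ioi,
    Measure.restrict_restrict measurableSet_Ioi, inter_eq_left.2 (Ioi_subset_Ioi hu.le),
    ← ofReal_integral_eq_lintegral_ofReal hint]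
  · rw [setIntegral_congr_fun measurableSet_Ioi hpow, integral_const_mul,
      integral_Ioi_rpow_of_lt (by norm_num) hu, show (-3 : ℝ) + 1 = -(2 : ℕ) by norm_num,
      Real.rpow_neg hu.le, Real.rpow_natCast]
    congr 1
    push_cast
    ring
  · refine (ae_restrict_iff' measurableSet_Ioi).2 (ae_of_all _ fun x hx => ?_)
    have hx : 0 < x := hu.trans hx
    positivity

lemma integral_ramp_paretoMeasure : ∫ x, ramp x ∂paretoMeasure = rampMass := by
  have hint : Integrable (fun x => ramp x) paretoMeasure := by
    refine Integrable.mono' (g := (Ioi (1 : ℝ)).indicator fun _ => 1) ?_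
      continuous_ramp.aestronglyMeasurable (ae_of_all _ fun x => ?_)
    · rw [integrable_indicator_iff measurableSet_Ioi]
      refine integrableOn_const ?_
      rw [paretoMeasure_Ioi one_pos]
      exact ENNReal.ofReal_ne_top
    · rw [Real.norm_of_nonneg (ramp_nonneg x)]
      by_cases hx : 1 < x
      · simpa [hx] using ramp_le_one x
      · simp [hx, ramp_eq_zero (not_lt.1 hx)]
  rw [integral_ramp (Y := fun x => x) hint, rampMass]
  refine setIntegral_congr_fun measurableSet_Ioi fun t ht => ?_
  have ht : 0 < t := ht
  have htail : paretoMeasure.real {x | 1 + t < x} = ((1 + t) ^ 2)⁻¹ := by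
    rw [measureReal_def, show {x | 1 + t < x} = Ioi (1 + t) from rfl,
      paretoMeasure_Ioi (by linarith), ENNReal.toReal_ofReal (by positivity)]
  simp only [indicator_apply, htail]

lemma integral_rampENN_radialMeasure :
    ∫ r : Radii, rampENN r ∂radialMeasure = rampMass := by
  have hz : ∀ r : ℝ≥0∞, r ∉ Ioi (0 : ℝ≥0∞) → rampENN r = 0 := fun r hr =>
    rampENN_eq_zero ((not_lt.1 hr).trans zero_le_one)
  rw [radialMeasure, integral_subtype_comap measurableSet_Ioi,
    setIntegral_eq_integral_of_forall_compl_eq_zero hz,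
    integral_map ENNReal.measurable_ofReal.aemeasurable
      continuous_rampENN.aestronglyMeasurable]
  simp_rw [rampENN_ofReal]
  exact integral_ramp_paretoMeasure

lemma _root_.MeasurableEmbedding.sFinite_comap {α β : Type*} [MeasurableSpace α]
    [MeasurableSpace β] {f : α → β} (hf : MeasurableEmbedding f) (μ : Measure β) [SFinite μ] :
    SFinite (μ.comap f) := by
  have : μ.comap f = Measure.sum fun n => (sfiniteSeq μ n).comap f := by
    ext s hs
    rw [hf.comap_apply, Measure.sum_apply _ hs]
    simp_rw [hf.comap_apply]
    rw [← Measure.sum_apply _ (hf.measurableSet_image.2 hs), sum_sfiniteSeq]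
  have hfin : ∀ n, IsFiniteMeasure ((sfiniteSeq μ n).comap f) := fun n => inferInstance
  rw [this]
  infer_instance

end Radial

/-! ### The limit along a single innovation -/

section OneInnovation

variable {Ω : Type*} [MeasurableSpace Ω] {P : Measure Ω} [IsProbabilityMeasure P]

lemma integrable_ramp {Y : Ω → ℝ} (hY : Measurable Y) : Integrable (fun ω => ramp (Y ω)) P :=
  Integrable.of_bound (continuous_ramp.measurable.comp hY).aestronglyMeasurable 1
    (ae_of_all _ fun ω => by rw [Real.norm_of_nonneg (ramp_nonneg _)]; exact ramp_le_one _)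

/-- The tail condition on `Z` determines the limit of the rescaled integrals of `ramp`, by the
layer-cake formula and dominated convergence. -/
lemma tendsto_integral_ramp {Z : Ω → ℝ} (hZm : Measurable Z)
    (hZ : ∀ z : ℝ, 0 < z → Tendsto (fun n : ℕ => (n : ℝ) * P.real {ω | z < Z ω / √(n : ℝ)}) atTop
      (𝓝 ((z ^ 2)⁻¹)))
    {r : ℝ} (hr : 0 ≤ r) :
    Tendsto (fun n : ℕ => (n : ℝ) * ∫ ω, ramp (r * (Z ω / √(n : ℝ))) ∂P) atTop
      (𝓝 (r ^ 2 * rampMass)) := by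
  rcases hr.eq_or_lt with rfl | hr
  · simp [ramp_eq_zero]
  have hlim : ∀ u : ℝ, 0 < u → Tendsto
      (fun n : ℕ => (n : ℝ) * P.real {ω | u < r * (Z ω / √(n : ℝ))}) atTop
      (𝓝 (r ^ 2 * (u ^ 2)⁻¹)) := fun u hu => by
    have h := hZ (u / r) (div_pos hu hr)
    simp_rw [div_lt_iff₀' hr] at h
    rwa [div_pow, inv_div, div_eq_mul_inv] at h
  obtain ⟨B, hB⟩ := (hlim 1 one_pos).bddAbove_range
  simp_rw [rampMass, ← integral_const_mul]
  have heq : ∀ n : ℕ, ∫ ω, (n : ℝ) * ramp (r * (Z ω / √(n : ℝ))) ∂P =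
      ∫ t in Ioi (0 : ℝ), (Iio 1).indicator
        (fun t => (n : ℝ) * P.real {ω | 1 + t < r * (Z ω / √(n : ℝ))}) t := fun n => by
    rw [integral_const_mul, integral_ramp (integrable_ramp (by fun_prop)), ← integral_const_mul]
    simp_rw [indicator_mul_right]
  simp_rw [heq]
  refine tendsto_integral_of_dominated_convergence ((Iio (1 : ℝ)).indicator fun _ => B)
    (fun n => ?_) (integrable_indicator_Iio_const B) (fun n => ?_) ?_
  · have hanti : Antitone fun t : ℝ => P.real {ω | 1 + t < r * (Z ω / √(n : ℝ))} :=
      fun t t' h => measureReal_mono fun ω hω => by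
        have hω : 1 + t' < r * (Z ω / √(n : ℝ)) := hω
        exact (by linarith : 1 + t < r * (Z ω / √(n : ℝ)))
    exact ((hanti.measurable.const_mul _).indicator measurableSet_Iio).aestronglyMeasurable
  · refine (ae_restrict_iff' measurableSet_Ioi).2 (ae_of_all _ fun t ht => ?_)
    have ht : 0 < t := ht
    rw [norm_indicator_eq_indicator_norm]
    refine indicator_le_indicator ?_
    rw [Real.norm_of_nonneg (by positivity)]
    refine le_trans (mul_le_mul_of_nonneg_left (measureReal_mono fun ω hω => ?_)
      (Nat.cast_nonneg n)) (hB ⟨n, rfl⟩)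
    have hω : 1 + t < r * (Z ω / √(n : ℝ)) := hω
    exact (by linarith : 1 < r * (Z ω / √(n : ℝ)))
  · refine (ae_restrict_iff' measurableSet_Ioi).2 (ae_of_all _ fun t ht => ?_)
    have ht : 0 < t := ht
    by_cases h1 : t < 1
    · simpa [h1] using hlim (1 + t) (by linarith)
    · simp [h1]

end OneInnovation

/-! ### Test functions in polar coordinates -/

section PolarTest

variable {V : Type*} [Fintype V]

/-- The test function `x ↦ ramp ‖x‖ * f (x / ‖x‖)`, which vanishes near the origin. -/
noncomputable def polarTest (f : EuclideanSpace ℝ V → ℝ) (x : EuclideanSpace ℝ V) : ℝ :=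
  ramp ‖x‖ * f (‖x‖⁻¹ • x)

variable {f : EuclideanSpace ℝ V → ℝ}

lemma polarTest_eq_zero {x : EuclideanSpace ℝ V} (hx : ‖x‖ ≤ 1) : polarTest f x = 0 := by
  rw [polarTest, ramp_eq_zero hx, zero_mul]

lemma measurable_polarTest (hf : Continuous f) : Measurable (polarTest f) :=
  (continuous_ramp.measurable.comp measurable_norm).mul
    (hf.measurable.comp (measurable_norm.inv.smul measurable_id))

lemma polarTest_smul {x : EuclideanSpace ℝ V} {y : ℝ} (hy : 0 ≤ y) :
    polarTest f (y • x) = ramp (‖x‖ * y) * f (‖x‖⁻¹ • x) := by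
  rcases hy.eq_or_lt with rfl | hy
  · simp [polarTest, ramp_eq_zero]
  · rw [polarTest, norm_smul, Real.norm_of_nonneg hy.le, smul_smul, mul_comm y, mul_inv,
      inv_mul_cancel_right₀ hy.ne']

lemma norm_inv_norm_smul_le (x : EuclideanSpace ℝ V) : ‖‖x‖⁻¹ • x‖ ≤ 1 := by
  rw [norm_smul, norm_inv, norm_norm]
  exact inv_mul_le_one

lemma exists_bound_polarTest (hf : Continuous f) :
    ∃ M, 0 ≤ M ∧ (∀ x, ‖x‖ ≤ 1 → |f x| ≤ M) ∧ ∀ x, |polarTest f x| ≤ M := by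
  obtain ⟨M, hM⟩ := (isCompact_closedBall (0 : EuclideanSpace ℝ V) 1).exists_bound_of_continuousOn
    hf.continuousOn
  have hM' : ∀ x, ‖x‖ ≤ 1 → |f x| ≤ M := fun x hx => hM x (mem_closedBall_zero_iff.2 hx)
  refine ⟨M, (abs_nonneg _).trans (hM' 0 (by simp)), hM', fun x => ?_⟩
  rw [polarTest, abs_mul, abs_of_nonneg (ramp_nonneg _)]
  exact (mul_le_of_le_one_left (abs_nonneg _) (ramp_le_one _)).trans
    (hM' _ (norm_inv_norm_smul_le x))

lemma norm_inv_smul_sub_le {x y : EuclideanSpace ℝ V} (hx : 1 / 2 ≤ ‖x‖) (hy : y ≠ 0) :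
    ‖‖x‖⁻¹ • x - ‖y‖⁻¹ • y‖ ≤ 4 * ‖x - y‖ := by
  have hx0 : 0 < ‖x‖ := by linarith
  have hy0 : 0 < ‖y‖ := norm_pos_iff.2 hy
  have h : ‖x‖⁻¹ • x - ‖y‖⁻¹ • y = ‖x‖⁻¹ • ((x - y) + (1 - ‖x‖ * ‖y‖⁻¹) • y) := by
    rw [smul_add, smul_smul, mul_sub, mul_one, ← mul_assoc, inv_mul_cancel₀ hx0.ne', one_mul,
      smul_sub, sub_smul]
    abel
  have h2 : ‖(1 - ‖x‖ * ‖y‖⁻¹) • y‖ ≤ ‖x - y‖ := by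
    rw [norm_smul, Real.norm_eq_abs, ← abs_norm y, ← abs_mul, abs_norm, sub_mul,
      inv_mul_cancel_right₀ hy0.ne', one_mul, abs_sub_comm]
    exact abs_norm_sub_norm_le x y
  rw [h, norm_smul, norm_inv, norm_norm]
  have h3 : ‖x‖⁻¹ ≤ 2 := by
    rw [inv_le_comm₀ hx0 two_pos]
    linarith
  calc ‖x‖⁻¹ * ‖(x - y) + (1 - ‖x‖ * ‖y‖⁻¹) • y‖ ≤ 2 * (‖x - y‖ + ‖x - y‖) := by
        gcongr
        exact (norm_add_le _ _).trans (by gcongr)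
    _ = 4 * ‖x - y‖ := by ring

/-- Uniform continuity of the test function on the whole space: the direction `x / ‖x‖` is Lipschitz
away from the origin, and near the origin the test function vanishes. -/
lemma exists_modulus_polarTest (hf : Continuous f) {ε : ℝ} (hε : 0 < ε) :
    ∃ δ > 0, ∀ x y, ‖x - y‖ < δ → |polarTest f x - polarTest f y| ≤ ε := by
  obtain ⟨M, hM0, hM, -⟩ := exists_bound_polarTest hf
  have huc := (isCompact_closedBall (0 : EuclideanSpace ℝ V) 1).uniformContinuousOn_of_continuous
    hf.continuousOn
  obtain ⟨δ, hδ, hfδ⟩ := Metric.uniformContinuousOn_iff.1 huc (ε / 2) (by positivity)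
  -- The bound `1 / 4` makes `y` nonzero when `‖x‖ ≥ 1 / 2`, and `‖y‖ ≤ 1` when `‖x‖ < 1 / 2`.
  refine ⟨min (1 / 4) (min (δ / 4) (ε / (2 * (M + 1)))), by positivity, fun x y hxy => ?_⟩
  rw [lt_min_iff, lt_min_iff] at hxy
  obtain ⟨h1, h2, h3⟩ := hxy
  have hnorm := abs_le.1 (abs_norm_sub_norm_le x y)
  by_cases hx : 1 / 2 ≤ ‖x‖
  · have hy : y ≠ 0 := norm_pos_iff.1 (by linarith [hnorm.2])
    have hdir : |f (‖x‖⁻¹ • x) - f (‖y‖⁻¹ • y)| ≤ ε / 2 := by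
      refine (hfδ _ (mem_closedBall_zero_iff.2 (norm_inv_norm_smul_le x)) _
        (mem_closedBall_zero_iff.2 (norm_inv_norm_smul_le y)) ?_).le
      rw [dist_eq_norm]
      exact (norm_inv_smul_sub_le hx hy).trans_lt (by linarith)
    have hrad : |ramp ‖x‖ - ramp ‖y‖| ≤ ‖x - y‖ :=
      (abs_ramp_sub_ramp_le _ _).trans (abs_norm_sub_norm_le x y)
    have h3' : ‖x - y‖ * (2 * (M + 1)) < ε := (lt_div_iff₀ (by positivity)).1 h3
    rw [show polarTest f x - polarTest f y = ramp ‖x‖ * (f (‖x‖⁻¹ • x) - f (‖y‖⁻¹ • y)) +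
      (ramp ‖x‖ - ramp ‖y‖) * f (‖y‖⁻¹ • y) by unfold polarTest; ring]
    refine (abs_add_le _ _).trans ?_
    rw [abs_mul, abs_mul, abs_of_nonneg (ramp_nonneg _)]
    have e1 : ramp ‖x‖ * |f (‖x‖⁻¹ • x) - f (‖y‖⁻¹ • y)| ≤ ε / 2 :=
      (mul_le_of_le_one_left (abs_nonneg _) (ramp_le_one _)).trans hdir
    have e2 : |ramp ‖x‖ - ramp ‖y‖| * |f (‖y‖⁻¹ • y)| ≤ ‖x - y‖ * M :=
      mul_le_mul hrad (hM _ (norm_inv_norm_smul_le y)) (abs_nonneg _) (norm_nonneg _)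
    nlinarith [norm_nonneg (x - y)]
  · rw [polarTest_eq_zero (by linarith), polarTest_eq_zero (by linarith [hnorm.1]), sub_zero,
      abs_zero]
    exact hε.le

end PolarTest

/-! ### A single large innovation -/

section BigJump

/-- Two innovations are of order `√n` simultaneously with probability `o(1 / n)` only. -/
lemma IsInnovation.tendsto_joint {V Ω : Type*} [MeasurableSpace Ω] {P : Measure Ω}
    {Z : V → Ω → ℝ} (hZ : IsInnovation P Z) {k l : V} (hkl : k ≠ l) {δ : ℝ} (hδ : 0 < δ) :
    Tendsto (fun n : ℕ => (n : ℝ) * P.real {ω | δ < Z k ω / √(n : ℝ) ∧ δ < Z l ω / √(n : ℝ)})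
      atTop (𝓝 0) := by
  have hprod : ∀ n : ℕ, P.real {ω | δ < Z k ω / √(n : ℝ) ∧ δ < Z l ω / √(n : ℝ)} =
      P.real {ω | δ < Z k ω / √(n : ℝ)} * P.real {ω | δ < Z l ω / √(n : ℝ)} := fun n => by
    have hs : MeasurableSet {z : ℝ | δ < z / √(n : ℝ)} :=
      measurableSet_lt measurable_const (measurable_id.div_const _)
    rw [measureReal_def, measureReal_def, measureReal_def, ← ENNReal.toReal_mul]
    exact congrArg _ ((hZ.indep.indepFun hkl).measure_inter_preimage_eq_mul _ _ hs hs)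
  have hl : Tendsto (fun n : ℕ => ((n : ℝ) * P.real {ω | δ < Z l ω / √(n : ℝ)}) * (n : ℝ)⁻¹)
      atTop (𝓝 ((δ ^ 2)⁻¹ * 0)) :=
    (hZ.standardised l δ hδ).mul tendsto_inv_atTop_nhds_zero_nat
  have h := (hZ.standardised k δ hδ).mul hl
  rw [mul_zero, mul_zero] at h
  refine h.congr' ?_
  -- `n p q = (n p) (n q) / n` for the two tail probabilities `p` and `q`.
  filter_upwards [eventually_ge_atTop 1] with n hn
  have hn : (n : ℝ) ≠ 0 := by positivity
  rw [hprod]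
  field_simp

variable {V : Type*} [Fintype V] {f : EuclideanSpace ℝ V → ℝ}

lemma norm_sum_smul_le {a : V → EuclideanSpace ℝ V} {y : V → ℝ} {δ : ℝ} (hy : ∀ k, 0 ≤ y k)
    (S : Finset V) (hδ : ∀ k ∈ S, y k ≤ δ) : ‖∑ k ∈ S, y k • a k‖ ≤ δ * ∑ k ∈ S, ‖a k‖ := by
  refine (norm_sum_le _ _).trans ?_
  rw [Finset.mul_sum]
  refine Finset.sum_le_sum fun k hk => ?_
  rw [norm_smul, Real.norm_of_nonneg (hy k)]
  exact mul_le_mul_of_nonneg_right (hδ k hk) (norm_nonneg _)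

/-- Along the sum `∑ k, y k • a k`, the test function is additive up to a small error whenever at
most one `y k` exceeds a small level `δ`. The level `η`, below which the test function vanishes,
does not depend on `ε`. -/
lemma abs_polarTest_sum_sub_le [DecidableEq V] (hf : Continuous f) (a : V → EuclideanSpace ℝ V) :
    ∃ η > 0, ∀ ε > 0, ∃ δ > 0, ∃ K : ℝ, ∀ y : V → ℝ, (∀ k, 0 ≤ y k) →
      |polarTest f (∑ k, y k • a k) - ∑ k, polarTest f (y k • a k)| ≤
        ε * ∑ k, (if η < y k then (1 : ℝ) else 0) +
        K * ∑ p ∈ (Finset.univ : Finset V).offDiag,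
          (if δ < y p.1 ∧ δ < y p.2 then (1 : ℝ) else 0) := by
  set A : ℝ := 1 + ∑ k, ‖a k‖ with hA
  have hsum0 : 0 ≤ ∑ k, ‖a k‖ := Finset.sum_nonneg fun k _ => norm_nonneg _
  have hA0 : 0 < A := by positivity
  have haA : ∀ k, ‖a k‖ ≤ A := fun k =>
    (Finset.single_le_sum (f := fun k => ‖a k‖) (fun k _ => norm_nonneg _)
      (Finset.mem_univ k)).trans (by linarith)
  obtain ⟨M, hM0, -, hM⟩ := exists_bound_polarTest hf
  -- All sums `∑ k, y k • a k` with `y k ≤ A⁻¹` lie in the unit ball, where the test function is 0.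
  refine ⟨A⁻¹, by positivity, fun ε hε => ?_⟩
  obtain ⟨δ', hδ', hmod⟩ := exists_modulus_polarTest hf hε
  refine ⟨min A⁻¹ (δ' / (2 * A)), by positivity, (1 + Fintype.card V) * M, fun y hy => ?_⟩
  set δ := min A⁻¹ (δ' / (2 * A)) with hδ
  have hδ0 : 0 < δ := by positivity
  have hδη : δ ≤ A⁻¹ := min_le_left _ _
  have hδA : δ * A < δ' := by
    have h : δ * (2 * A) ≤ δ' := (le_div_iff₀ (by positivity)).1 (min_le_right _ _)
    nlinarith
  have hs1 : 0 ≤ ∑ k, (if A⁻¹ < y k then (1 : ℝ) else 0) :=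
    Finset.sum_nonneg fun k _ => by split_ifs <;> norm_num
  have hs2 : 0 ≤ ∑ p ∈ (Finset.univ : Finset V).offDiag,
      (if δ < y p.1 ∧ δ < y p.2 then (1 : ℝ) else 0) :=
    Finset.sum_nonneg fun k _ => by split_ifs <;> norm_num
  have hsmall : ∀ k, y k ≤ A⁻¹ → polarTest f (y k • a k) = 0 := fun k hk => by
    refine polarTest_eq_zero ?_
    rw [norm_smul, Real.norm_of_nonneg (hy k)]
    calc y k * ‖a k‖ ≤ A⁻¹ * A := mul_le_mul hk (haA k) (norm_nonneg _) (by positivity)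
      _ = 1 := inv_mul_cancel₀ hA0.ne'
  by_cases htwo : ∃ p ∈ (Finset.univ : Finset V).offDiag, δ < y p.1 ∧ δ < y p.2
  · -- Two large innovations: bound every term by `M`.
    obtain ⟨p, hp, hpy⟩ := htwo
    have h1 : (1 : ℝ) ≤ ∑ p ∈ (Finset.univ : Finset V).offDiag,
        (if δ < y p.1 ∧ δ < y p.2 then (1 : ℝ) else 0) := by
      have h := Finset.single_le_sum (f := fun p : V × V =>
        if δ < y p.1 ∧ δ < y p.2 then (1 : ℝ) else 0)
        (fun p _ => by split_ifs <;> norm_num) hp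
      simpa [hpy] using h
    have h2 : |polarTest f (∑ k, y k • a k) - ∑ k, polarTest f (y k • a k)| ≤
        (1 + Fintype.card V) * M := by
      refine (abs_sub _ _).trans ?_
      have h3 : |∑ k, polarTest f (y k • a k)| ≤ Fintype.card V * M := by
        refine (Finset.abs_sum_le_sum_abs _ _).trans ?_
        refine (Finset.sum_le_sum fun k _ => hM (y k • a k)).trans ?_
        simp
      linarith [hM (∑ k, y k • a k)]
    have h4 : 0 ≤ (1 + (Fintype.card V : ℝ)) * M := by positivity
    nlinarith [mul_nonneg hε.le hs1]
  push Not at htwo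
  have hK : 0 ≤ (1 + (Fintype.card V : ℝ)) * M := by positivity
  by_cases hone : ∃ k, A⁻¹ < y k
  · -- Exactly one large innovation `k`: the others perturb the argument by less than `δ'`.
    obtain ⟨k, hk⟩ := hone
    have hl : ∀ l, l ≠ k → y l ≤ δ := fun l hlk =>
      htwo (k, l) (by simp [hlk.symm]) (hδη.trans_lt hk)
    rw [Finset.sum_eq_single (f := fun k => polarTest f (y k • a k)) k
      (fun l _ hlk => hsmall l ((hl l hlk).trans hδη)) (by simp)]
    have h1 : (1 : ℝ) ≤ ∑ k, (if A⁻¹ < y k then (1 : ℝ) else 0) := by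
      have h := Finset.single_le_sum (f := fun k : V => if A⁻¹ < y k then (1 : ℝ) else 0)
        (fun p _ => by split_ifs <;> norm_num) (Finset.mem_univ k)
      simpa [hk] using h
    have h2 : |polarTest f (∑ k, y k • a k) - polarTest f (y k • a k)| ≤ ε := by
      refine hmod _ _ ?_
      rw [← Finset.add_sum_erase _ _ (Finset.mem_univ k), add_sub_cancel_left]
      refine (norm_sum_smul_le hy _ fun l hl' => hl l (Finset.ne_of_mem_erase hl')).trans_lt ?_
      refine lt_of_le_of_lt (mul_le_mul_of_nonneg_left ?_ hδ0.le) hδA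
      exact (Finset.sum_le_sum_of_subset_of_nonneg (Finset.subset_univ _)
        fun _ _ _ => norm_nonneg _).trans (by linarith)
    nlinarith [mul_nonneg hK hs2]
  · -- No large innovation: both sides of the comparison vanish.
    push Not at hone
    have h1 : ‖∑ k, y k • a k‖ ≤ 1 := by
      refine (norm_sum_smul_le hy _ fun k _ => hone k).trans ?_
      calc A⁻¹ * ∑ k, ‖a k‖ ≤ A⁻¹ * A := by gcongr; linarith
        _ = 1 := inv_mul_cancel₀ hA0.ne'
    rw [polarTest_eq_zero h1, Finset.sum_eq_zero fun k _ => hsmall k (hone k), sub_zero, abs_zero]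
    exact add_nonneg (mul_nonneg hε.le hs1) (mul_nonneg hK hs2)

variable {Ω : Type*} [MeasurableSpace Ω] {P : Measure Ω} [IsProbabilityMeasure P]
  {Z : V → Ω → ℝ}

/-- The tail of a linear combination of the innovations is asymptotically the superposition of the
tails of its summands. -/
lemma IsInnovation.tendsto_sub [DecidableEq V] (hZ : IsInnovation P Z) (hf : Continuous f)
    (a : V → EuclideanSpace ℝ V) :
    Tendsto (fun n : ℕ => (n : ℝ) * ∫ ω, (polarTest f (∑ k, (Z k ω / √(n : ℝ)) • a k) -
      ∑ k, polarTest f ((Z k ω / √(n : ℝ)) • a k)) ∂P) atTop (𝓝 0) := by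
  obtain ⟨η, hη, hmain⟩ := abs_polarTest_sum_sub_le hf a
  rw [Metric.tendsto_atTop']
  intro ε hε
  -- `N` is the limit of the rescaled expected number of innovations above the level `η`.
  set N : ℝ := Fintype.card V * (η ^ 2)⁻¹ with hN
  have hN0 : 0 ≤ N := by positivity
  obtain ⟨δ, hδ, K, hbound⟩ := hmain (ε / (N + 1)) (by positivity)
  have hlim : Tendsto (fun n : ℕ =>
      ε / (N + 1) * ∑ k, (n : ℝ) * P.real {ω | η < Z k ω / √(n : ℝ)} +
      K * ∑ p ∈ (Finset.univ : Finset V).offDiag,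
        (n : ℝ) * P.real {ω | δ < Z p.1 ω / √(n : ℝ) ∧ δ < Z p.2 ω / √(n : ℝ)}) atTop
      (𝓝 (ε / (N + 1) * ∑ _k : V, (η ^ 2)⁻¹ +
        K * ∑ _p ∈ (Finset.univ : Finset V).offDiag, 0)) :=
    ((tendsto_finsetSum _ fun k _ => hZ.standardised k η hη).const_mul _).add
      ((tendsto_finsetSum _ fun p hp =>
        hZ.tendsto_joint (Finset.mem_offDiag.1 hp).2.2 hδ).const_mul _)
  have hlt : ε / (N + 1) * ∑ _k : V, (η ^ 2)⁻¹ +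
      K * ∑ _p ∈ (Finset.univ : Finset V).offDiag, 0 < ε := by
    rw [Finset.sum_const_zero, mul_zero, add_zero, Finset.sum_const, Finset.card_univ,
      nsmul_eq_mul, ← hN, div_mul_eq_mul_div, div_lt_iff₀ (by positivity)]
    nlinarith
  obtain ⟨n₀, hn₀⟩ := eventually_atTop.1 (hlim.eventually_lt_const hlt)
  refine ⟨n₀, fun n hn => ?_⟩
  rw [Real.dist_0_eq_abs]
  refine lt_of_le_of_lt ?_ (hn₀ n hn.le)
  have hm1 : ∀ k, MeasurableSet {ω | η < Z k ω / √(n : ℝ)} := fun k =>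
    measurableSet_lt measurable_const ((hZ.measurable k).div_const _)
  have hm2 : ∀ p : V × V,
      MeasurableSet {ω | δ < Z p.1 ω / √(n : ℝ) ∧ δ < Z p.2 ω / √(n : ℝ)} := fun p =>
    (measurableSet_lt measurable_const ((hZ.measurable p.1).div_const _)).inter
      (measurableSet_lt measurable_const ((hZ.measurable p.2).div_const _))
  have hind : ∀ {s : Set Ω}, MeasurableSet s → Integrable (s.indicator fun _ => (1 : ℝ)) P :=
    fun hs => (integrable_const 1).indicator hs
  have hint1 : Integrable (fun ω => ∑ k, {ω | η < Z k ω / √(n : ℝ)}.indicator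
      (fun _ => (1 : ℝ)) ω) P := integrable_finsetSum _ fun k _ => hind (hm1 k)
  have hint2 : Integrable (fun ω => ∑ p ∈ (Finset.univ : Finset V).offDiag,
      {ω | δ < Z p.1 ω / √(n : ℝ) ∧ δ < Z p.2 ω / √(n : ℝ)}.indicator (fun _ => (1 : ℝ)) ω) P :=
    integrable_finsetSum _ fun p _ => hind (hm2 p)
  have hle : |∫ ω, (polarTest f (∑ k, (Z k ω / √(n : ℝ)) • a k) -
      ∑ k, polarTest f ((Z k ω / √(n : ℝ)) • a k)) ∂P| ≤
      ∫ ω, (ε / (N + 1) * ∑ k, {ω | η < Z k ω / √(n : ℝ)}.indicator (fun _ => (1 : ℝ)) ω +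
        K * ∑ p ∈ (Finset.univ : Finset V).offDiag,
          {ω | δ < Z p.1 ω / √(n : ℝ) ∧ δ < Z p.2 ω / √(n : ℝ)}.indicator
            (fun _ => (1 : ℝ)) ω) ∂P := by
    refine abs_integral_le_integral_abs.trans
      (integral_mono_of_nonneg (ae_of_all _ fun ω => abs_nonneg _)
      ((hint1.const_mul _).add (hint2.const_mul _)) ?_)
    filter_upwards [ae_all_iff.2 hZ.nonneg] with ω hω
    have h := hbound (fun k => Z k ω / √(n : ℝ)) fun k => div_nonneg (hω k) (Real.sqrt_nonneg _)
    simpa only [indicator_apply, mem_ofPred_eq] using h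
  rw [integral_add (hint1.const_mul _) (hint2.const_mul _), integral_const_mul,
    integral_const_mul, integral_finsetSum _ fun k _ => hind (hm1 k),
    integral_finsetSum _ fun p _ => hind (hm2 p)] at hle
  simp only [integral_indicator_const _ (hm1 _), integral_indicator_const _ (hm2 _),
    smul_eq_mul, mul_one] at hle
  rw [abs_mul, Nat.abs_cast]
  refine (mul_le_mul_of_nonneg_left hle (Nat.cast_nonneg n)).trans_eq ?_
  simp only [← Finset.mul_sum]
  ring

lemma integrable_polarTest (hf : Continuous f) {Y : Ω → EuclideanSpace ℝ V} (hY : Measurable Y) :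
    Integrable (fun ω => polarTest f (Y ω)) P := by
  obtain ⟨M, -, -, hM⟩ := exists_bound_polarTest hf
  exact Integrable.of_bound ((measurable_polarTest hf).comp hY).aestronglyMeasurable M
    (ae_of_all _ fun ω => hM _)

/-- The limit of the rescaled polar law of `∑ k, Z k • a k`, tested against `ramp × f`: the
innovation `k` contributes an atom in the direction of `a k`, of mass `‖a k‖ ^ 2`. -/
lemma IsInnovation.tendsto_integral_polarTest [DecidableEq V] (hZ : IsInnovation P Z)
    (hf : Continuous f) (a : V → EuclideanSpace ℝ V) :
    Tendsto (fun n : ℕ => (n : ℝ) * ∫ ω, polarTest f (∑ k, (Z k ω / √(n : ℝ)) • a k) ∂P) atTop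
      (𝓝 (rampMass * ∑ k, ‖a k‖ ^ 2 * f (‖a k‖⁻¹ • a k))) := by
  have hZm := hZ.measurable
  have hmeas : ∀ (n : ℕ) k, Measurable fun ω => (Z k ω / √(n : ℝ)) • a k := fun n k =>
    ((hZm k).div_const _).smul_const _
  have hone : ∀ k, Tendsto (fun n : ℕ => (n : ℝ) *
      ∫ ω, polarTest f ((Z k ω / √(n : ℝ)) • a k) ∂P) atTop
      (𝓝 (‖a k‖ ^ 2 * rampMass * f (‖a k‖⁻¹ • a k))) := fun k => by
    refine ((tendsto_integral_ramp (hZm k) (hZ.standardised k) (norm_nonneg (a k))).mul_const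
      (f (‖a k‖⁻¹ • a k))).congr fun n => ?_
    rw [mul_assoc, ← integral_mul_const]
    congr 1
    refine integral_congr_ae ?_
    filter_upwards [hZ.nonneg k] with ω hω
    exact (polarTest_smul (div_nonneg hω (Real.sqrt_nonneg _))).symm
  have h := (hZ.tendsto_sub hf a).add
    (tendsto_finsetSum Finset.univ fun k _ => hone k)
  rw [zero_add] at h
  have hval : ∑ k, ‖a k‖ ^ 2 * rampMass * f (‖a k‖⁻¹ • a k) =
      rampMass * ∑ k, ‖a k‖ ^ 2 * f (‖a k‖⁻¹ • a k) := by
    rw [Finset.mul_sum]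
    exact Finset.sum_congr rfl fun k _ => by ring
  rw [hval] at h
  refine h.congr fun n => ?_
  rw [integral_sub, integral_finsetSum, ← Finset.mul_sum, ← mul_add, sub_add_cancel]
  · exact fun k _ => integrable_polarTest hf (hmeas n k)
  · exact integrable_polarTest hf (Finset.measurable_sum _ fun k _ => hmeas n k)
  · exact integrable_finsetSum _ fun k _ => integrable_polarTest hf (hmeas n k)

end BigJump

/-! ### The angular measure of a linear structural equation model -/

section Angular

variable {V : Type*} [Fintype V]

lemma isCompact_posSphere :
    IsCompact {θ : EuclideanSpace ℝ V | (∀ i, 0 ≤ θ i) ∧ ‖θ‖ = 1} := by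
  refine (isCompact_sphere (0 : EuclideanSpace ℝ V) 1).of_isClosed_subset ?_
    fun θ h => by simpa using h.2
  simp only [ofPred_and, ofPred_forall]
  exact (isClosed_iInter fun i => isClosed_le continuous_const (by fun_prop)).inter
    (isClosed_eq continuous_norm continuous_const)

instance : CompactSpace (PosSphere V) := isCompact_iff_compactSpace.1 isCompact_posSphere

lemma measurableEmbedding_polar :
    MeasurableEmbedding (fun p : Radii × PosSphere V =>
      ((p.1 : ℝ≥0∞), (p.2 : EuclideanSpace ℝ V))) :=
  (MeasurableEmbedding.subtype_coe measurableSet_Ioi).prodMap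
    (MeasurableEmbedding.subtype_coe isCompact_posSphere.isClosed.measurableSet)

lemma continuous_polarProd {E : Type*} [TopologicalSpace E] {f : E → ℝ} (hf : Continuous f) :
    Continuous fun p : ℝ≥0∞ × E => rampENN p.1 * f p.2 :=
  (continuous_rampENN.comp continuous_fst).mul (hf.comp continuous_snd)

lemma hasCompactSupport_polarProd (f : EuclideanSpace ℝ V → ℝ) :
    HasCompactSupport fun p : Radii × PosSphere V => rampENN p.1 * f p.2 := by
  have hK : IsCompact ((Subtype.val : Radii → ℝ≥0∞) ⁻¹' Icc 1 ⊤) :=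
    Topology.IsInducing.subtypeVal.isCompact_preimage' isCompact_Icc
      (by rw [Subtype.range_coe]; exact fun r hr => zero_lt_one.trans_le hr.1)
  refine HasCompactSupport.intro (hK.prod isCompact_univ) fun p hp => ?_
  have hp1 : (p.1 : ℝ≥0∞) ≤ 1 := by
    by_contra h
    exact hp ⟨⟨(not_le.1 h).le, le_top⟩, mem_univ _⟩
  rw [rampENN_eq_zero hp1, zero_mul]

variable {Ω : Type*} [MeasurableSpace Ω] {P : Measure Ω} {X : Ω → EuclideanSpace ℝ V}
  {f : EuclideanSpace ℝ V → ℝ}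

/-- Passage from polar coordinates to `X`: the integral of `ramp × f` is that of a function of
`X / b`. -/
lemma integral_polarLaw (hXm : Measurable X) (hX0 : ∀ᵐ ω ∂P, ∀ i, 0 ≤ X ω i)
    (hf : Continuous f) {b : ℝ} (hb : 0 < b) :
    ∫ p, rampENN p.1 * f p.2 ∂(polarLaw P X b) = ∫ ω, polarTest f (b⁻¹ • X ω) ∂P := by
  have hmeas : Measurable fun ω => (ENNReal.ofReal (‖X ω‖ / b), ‖X ω‖⁻¹ • X ω) :=
    (ENNReal.measurable_ofReal.comp (hXm.norm.div_const b)).prodMk (hXm.norm.inv.smul hXm)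
  set e := fun p : Radii × PosSphere V => ((p.1 : ℝ≥0∞), (p.2 : EuclideanSpace ℝ V)) with he
  set g := fun p : ℝ≥0∞ × EuclideanSpace ℝ V => rampENN p.1 * f p.2 with hg
  have hemb : MeasurableEmbedding e := measurableEmbedding_polar
  have hgm : Measurable g := (continuous_polarProd hf).measurable
  have h1 : ∫ p, rampENN p.1 * f p.2 ∂(polarLaw P X b) =
      ∫ q, (range e).indicator g q
        ∂(Measure.map (fun ω => (ENNReal.ofReal (‖X ω‖ / b), ‖X ω‖⁻¹ • X ω)) P) := by
    rw [integral_indicator hemb.measurableSet_range, ← hemb.map_comap, hemb.integral_map]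
    rfl
  rw [h1, integral_map hmeas.aemeasurable
    (hgm.indicator hemb.measurableSet_range).aestronglyMeasurable]
  refine integral_congr_ae ?_
  filter_upwards [hX0] with ω hω
  -- If `X ω = 0` then the point lies outside the range of `e`, and the test function is 0.
  rcases eq_or_ne (X ω) 0 with h0 | h0
  · rw [h0, smul_zero, polarTest_eq_zero (by simp)]
    refine indicator_apply_eq_zero.2 fun _ => ?_
    simp [hg, rampENN_eq_zero]
  have hn : 0 < ‖X ω‖ := norm_pos_iff.2 h0
  rw [indicator_of_mem, polarTest_smul (by positivity), div_eq_mul_inv]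
  · simp only [hg, rampENN_ofReal]
  refine ⟨(⟨ENNReal.ofReal (‖X ω‖ / b), ENNReal.ofReal_pos.2 (by positivity)⟩,
    ⟨‖X ω‖⁻¹ • X ω, fun i => ?_, ?_⟩), rfl⟩
  · exact mul_nonneg (by positivity) (hω i)
  · rw [norm_smul, norm_inv, norm_norm, inv_mul_cancel₀ hn.ne']

/-- The angular measure of a linear combination of the innovations with nonnegative coefficients:
it has an atom of mass `‖a k‖ ^ 2` at `a k / ‖a k‖`, for every column `a k` of coefficients. -/
lemma integral_angularMeasure [DecidableEq V] [IsProbabilityMeasure P] {Z : V → Ω → ℝ}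
    (hZ : IsInnovation P Z)
    (hXm : Measurable X) {a : V → EuclideanSpace ℝ V} (ha : ∀ k i, 0 ≤ a k i)
    (hX : ∀ᵐ ω ∂P, X ω = ∑ k, Z k ω • a k) {H : Measure (PosSphere V)}
    (hH : IsAngularMeasure P X H) (hf : Continuous f) :
    ∫ θ : PosSphere V, f θ ∂H = ∑ k, ‖a k‖ ^ 2 * f (‖a k‖⁻¹ • a k) := by
  have := hH.finite
  have : SFinite radialMeasure :=
    (MeasurableEmbedding.subtype_coe measurableSet_Ioi).sFinite_comap _
  have hX0 : ∀ᵐ ω ∂P, ∀ i, 0 ≤ X ω i := by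
    filter_upwards [hX, ae_all_iff.2 hZ.nonneg] with ω hω hω0 i
    rw [hω]
    simp only [WithLp.ofLp_sum, WithLp.ofLp_smul, Finset.sum_apply, Pi.smul_apply, smul_eq_mul]
    exact Finset.sum_nonneg fun k _ => mul_nonneg (hω0 k) (ha k i)
  have hleft := hH.tendsto (fun p => rampENN p.1 * f p.2)
    ((continuous_polarProd hf).comp ((continuous_subtype_val.comp continuous_fst).prodMk
      (continuous_subtype_val.comp continuous_snd))) (hasCompactSupport_polarProd f)
  rw [integral_prod_mul (fun r : Radii => rampENN r) (fun θ : PosSphere V => f θ),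
    integral_rampENN_radialMeasure] at hleft
  refine mul_left_cancel₀ rampMass_pos.ne' (tendsto_nhds_unique hleft
    ((hZ.tendsto_integral_polarTest hf a).congr' ?_))
  filter_upwards [eventually_ge_atTop 1] with n hn
  have hn : (0 : ℝ) < n := by positivity
  rw [integral_smul_measure, ENNReal.toReal_natCast, smul_eq_mul,
    integral_polarLaw hXm hX0 hf (Real.sqrt_pos.2 hn)]
  congr 1
  refine integral_congr_ae ?_
  filter_upwards [hX] with ω hω
  rw [hω, Finset.smul_sum]
  simp_rw [smul_smul, div_eq_inv_mul]

/-- The squared scalings in terms of the coefficients of the innovations in the solution of the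
structural equations. -/
lemma sqScaling_eq_sum [DecidableEq V] [IsProbabilityMeasure P]
    {D : Digraph V} {c : V → V → ℝ} {s : V → ℝ} {T : V → V → ℝ} {Z : V → Ω → ℝ}
    (hZ : IsInnovation P Z) (hX : IsLSEMPlus P D c s Z X) (hT : IsPathWeight D c T)
    {H : Measure (PosSphere V)} (hH : IsAngularMeasure P X H) (S : Finset V) (hS : S.Nonempty)
    (b : V → ℝ) :
    sqScaling H S hS b = ∑ l, S.sup' hS (fun k => (b k * (T k l * s l)) ^ 2) := by
  have hT0 := hT.nonneg hX.acyclic hX.edge_pos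
  set a : V → EuclideanSpace ℝ V := fun l => WithLp.toLp 2 fun k => T k l * s l with ha
  have hsol : ∀ᵐ ω ∂P, X ω = ∑ k, Z k ω • a k := by
    filter_upwards [hX.equation] with ω hω
    ext i
    rw [hT.solve hX.acyclic hω i]
    simp only [WithLp.ofLp_sum, WithLp.ofLp_smul, Finset.sum_apply, Pi.smul_apply, smul_eq_mul, ha]
    exact Finset.sum_congr rfl fun k _ => by ring
  have hf : Continuous fun x : EuclideanSpace ℝ V => S.sup' hS fun k => (b k * x k) ^ 2 :=
    Continuous.finset_sup'_apply hS fun k _ => by fun_prop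
  rw [sqScaling, integral_angularMeasure hZ hX.measurable
    (fun k i => mul_nonneg (hT0 i k) (hX.innov_pos k).le) hsol hH hf]
  refine Finset.sum_congr rfl fun l _ => ?_
  have ha0 : 0 < ‖a l‖ := by
    refine norm_pos_iff.2 fun h => (hX.innov_pos l).ne' ?_
    have h' : a l l = 0 := by rw [h]; rfl
    simpa [ha, hT.self hX.acyclic] using h'
  rw [Finset.apply_sup'_eq_sup'_comp hS (fun x => ‖a l‖ ^ 2 * x)
    fun x y => mul_max_of_nonneg x y (sq_nonneg _)]
  refine Finset.sup'_congr hS rfl fun k _ => ?_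
  simp only [Function.comp_apply, WithLp.ofLp_smul, Pi.smul_apply, smul_eq_mul]
  rw [mul_left_comm, mul_pow ‖a l‖⁻¹, ← mul_assoc, ← mul_pow, mul_inv_cancel₀ ha0.ne', one_pow,
    one_mul]

end Angular

end ExtremalLSEM

theorem mainTheorem2 {V : Type*} [Fintype V] [DecidableEq V]
    {Ω : Type*} [MeasurableSpace Ω] (P : Measure Ω) [IsProbabilityMeasure P]
    (D : Digraph V) (c : V → V → ℝ) (s : V → ℝ)
    (Z : V → Ω → ℝ) (X : Ω → EuclideanSpace ℝ V)
    (hZ : IsInnovation P Z) (hX : IsLSEMPlus P D c s Z X)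
    (H : Measure (PosSphere V)) (hH : IsAngularMeasure P X H)
    (hstd : ∀ i, sqScalingNode H i = 1)
    (I : Finset V) (hI : ∀ i ∈ I, ancestors D i ⊆ (I : Set V))
    (j : V) (hj : j ∉ I) :
    (ancestors D j ⊆ (I : Set V) ↔
      ∃ a : ℝ, 1 < a ∧ ∀ i ∉ insert j I,
        sqScalingMaxRescaled H a i j I - sqScalingMax H i (insert j I)
          = (a ^ 2 - 1) * sqScalingMax H j I) ∧
    (¬ ancestors D j ⊆ (I : Set V) →
      ∀ a : ℝ, 1 < a → ∀ i ∉ insert j I,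
        sqScalingMaxRescaled H a i j I - sqScalingMax H i (insert j I)
            ≤ (a ^ 2 - 1) * sqScalingMax H j I ∧
        (i ∈ ancestors D j →
          sqScalingMaxRescaled H a i j I - sqScalingMax H i (insert j I)
            < (a ^ 2 - 1) * sqScalingMax H j I)) := by
  have hD := hX.acyclic
  have hc := hX.edge_pos
  have hs := hX.innov_pos
  obtain ⟨T, hT⟩ := exists_isPathWeight hD c
  have hT0 := hT.nonneg hD hc
  have hscal := sqScaling_eq_sum hZ hX hT hH
  have hrow : ∀ i, ∑ l, (T i l * s l) ^ 2 = 1 := fun i => by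
    have := hstd i
    rw [sqScalingNode, hscal] at this
    simpa using this
  have hlt : ∀ {i k : V}, i ≠ k → T i k < 1 := fun h => hT.lt_one hD hc hs hrow h
  have hne := Finset.insert_nonempty j I
  -- The squared contribution of the innovation `l` to the maximum over `I ∪ {j}`.
  set m : V → ℝ := fun l => (insert j I).sup' hne fun k => (T k l * s l) ^ 2 with hm
  have hle : ∀ {l k : V}, k ∈ insert j I → (T k l * s l) ^ 2 ≤ m l := fun {l k} hk =>
    Finset.le_sup' (fun k => (T k l * s l) ^ 2) hk
  have hm0 : ∀ l, 0 ≤ m l := fun l => (sq_nonneg _).trans (hle (Finset.mem_insert_self j I))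
  have hright : ∀ a : ℝ, (a ^ 2 - 1) * sqScalingMax H j I = ∑ l, (a ^ 2 - 1) * m l := fun a => by
    rw [sqScalingMax, hscal, Finset.mul_sum]
    simp only [one_mul, hm]
  have hleft : ∀ a : ℝ, ∀ i ∉ insert j I,
      sqScalingMaxRescaled H a i j I - sqScalingMax H i (insert j I) =
        ∑ l, (max ((T i l * s l) ^ 2) (a ^ 2 * m l) - max ((T i l * s l) ^ 2) (m l)) := by
    intro a i hi
    rw [sqScalingMaxRescaled, sqScalingMax, hscal, hscal, ← Finset.sum_sub_distrib]
    refine Finset.sum_congr rfl fun l _ => ?_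
    rw [sup'_insert_rescale (fun k => T k l * s l) hne hi, Finset.sup'_insert hne]
    simp only [one_mul, hm]
  have hsq : ∀ {a : ℝ}, 1 < a → 1 < a ^ 2 := fun ha => one_lt_pow₀ ha two_ne_zero
  have key : ∀ a : ℝ, 1 < a → ∀ i ∉ insert j I,
      sqScalingMaxRescaled H a i j I - sqScalingMax H i (insert j I)
        ≤ (a ^ 2 - 1) * sqScalingMax H j I := by
    intro a ha i hi
    rw [hleft a i hi, hright]
    exact Finset.sum_le_sum fun l _ => max_mul_sub_max_le (hm0 l) (hsq ha)
  -- An ancestor `i ∉ I` of `j` has a larger coefficient at its own innovation than any node of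
  -- `I ∪ {j}`, and that of `j` is positive.
  have strict : ∀ a : ℝ, 1 < a → ∀ i ∉ insert j I, i ∈ ancestors D j →
      sqScalingMaxRescaled H a i j I - sqScalingMax H i (insert j I)
        < (a ^ 2 - 1) * sqScalingMax H j I := by
    intro a ha i hi hij
    rw [hleft a i hi, hright]
    refine Finset.sum_lt_sum (fun l _ => max_mul_sub_max_le (hm0 l) (hsq ha))
      ⟨i, Finset.mem_univ i, max_mul_sub_max_lt ?_ (hsq ha) ?_⟩
    · exact (pow_pos (mul_pos (hT.pos hD hc hij) (hs i)) 2).trans_le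
        (hle (Finset.mem_insert_self j I))
    · refine (Finset.sup'_lt_iff hne).2 fun k hk => ?_
      have hki : k ≠ i := by rintro rfl; exact hi hk
      refine pow_lt_pow_left₀ ?_ (mul_nonneg (hT0 k i) (hs i).le) two_ne_zero
      exact mul_lt_mul_of_pos_right ((hlt hki).trans_eq (hT.self hD i).symm) (hs i)
  refine ⟨⟨fun hanc => ⟨2, one_lt_two, fun i hi => ?_⟩, fun ⟨a, ha, h⟩ => ?_⟩,
    fun _ a ha i hi => ⟨key a ha i hi, strict a ha i hi⟩⟩
  · rw [hleft 2 i hi, hright]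
    refine Finset.sum_congr rfl fun l _ => ?_
    by_cases hl : l ∈ insert j I
    · refine max_mul_sub_max_eq (hm0 l) (hsq one_lt_two) ((pow_le_pow_left₀
        (mul_nonneg (hT0 i l) (hs l).le) ?_ 2).trans (hle hl))
      have hil : i ≠ l := by rintro rfl; exact hi hl
      exact mul_le_mul_of_nonneg_right ((hlt hil).le.trans_eq (hT.self hD l).symm) (hs l).le
    · -- `I ∪ {j}` is closed under ancestors, so it does not involve the innovation `l`.
      have hml : m l = 0 := by
        refine le_antisymm (Finset.sup'_le hne _ fun k hk => ?_) (hm0 l)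
        rw [hT.eq_zero hD (by rintro rfl; exact hl hk), zero_mul, zero_pow two_ne_zero]
        intro hlk
        rcases Finset.mem_insert.1 hk with rfl | hk
        · exact hl (Finset.mem_insert_of_mem (hanc hlk))
        · exact hl (Finset.mem_insert_of_mem (hI k hk hlk))
      simp [hml]
  · by_contra hanc
    obtain ⟨i, hij, hiI⟩ := Set.not_subset.1 hanc
    have hi : i ∉ insert j I := by
      rw [Finset.mem_insert, not_or]
      exact ⟨by rintro rfl; exact hD i hij, hiI⟩
    exact (strict a ha i hi hij).ne (h i hi)
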